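/- All graphs are finite, undirected, without loops or parallel edges. A graph is claw-free if it has no induced subgraph isomorphic to $K_{1,3}$. A graph is 2-connected if it has at least three vertices and is connected, and deleting any one vertex leaves a connected graph. A $\Lambda$-factor of a graph $G$ is a spanning subgraph of $G$ each of whose connected components is isomorphic to the path with three vertices. Let $v(G)$ denote the number of vertices of $G$. Let $G$ be a 2-connected claw-free graph with $v(G) \equiv 1 \pmod 3$. Then for every vertex $x \in V(G)$ the graph $G - x$, obtained from $G$ by deleting $x$ and all edges incident to $x$, has a $\Lambda$-factor. -/

import Mathlib

/-- `H`-packing of `G`: a subgraph of `G` each component of which is isomorphic to `H`. -/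
def SimpleGraph.Subgraph.IsPacking {V W : Type*} {G : SimpleGraph V} (P : G.Subgraph)
    (H : SimpleGraph W) : Prop :=
  ∀ C : P.coe.ConnectedComponent, Nonempty (C.toSimpleGraph ≃g H)

/-- `H`-factor of `G`: a spanning `H`-packing. -/
def SimpleGraph.Subgraph.IsFactor {V W : Type*} {G : SimpleGraph V} (P : G.Subgraph)
    (H : SimpleGraph W) : Prop :=
  P.IsPacking H ∧ P.IsSpanning

/-- `G` has a `Λ`-factor, where `Λ` is the path with three vertices. -/
def SimpleGraph.HasLambdaFactor {V : Type*} (G : SimpleGraph V) : Prop :=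
  ∃ P : G.Subgraph, P.IsFactor (SimpleGraph.pathGraph 3)

/-- `G` is claw-free: it has no induced subgraph isomorphic to the claw `K_{1,3}`. -/
def SimpleGraph.IsClawFree {V : Type*} (G : SimpleGraph V) : Prop :=
  ¬ (completeBipartiteGraph (Fin 1) (Fin 3)).IsIndContained G

/-- A finite graph `G` is `k`-connected: it has more than `k` vertices, and deleting any set of
fewer than `k` vertices leaves a connected graph. -/
def SimpleGraph.IsKConnected {V : Type*} [Fintype V] (k : ℕ) (G : SimpleGraph V) : Prop :=
  k < Fintype.card V ∧ ∀ X : Finset V, X.card < k → (G.induce (X : Set V)ᶜ).Connected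

set_option linter.unusedSectionVars false

/-! In a claw-free graph a cut vertex `c` of a connected set is harmless: its neighbours on each
side form a clique and each side is connected. If `x` is deleted from a 2-connected graph, what
remains is therefore either nonseparable or a row of blocks whose two ends contain neighbours of `x`
(`chain_erase`), and the theorem reduces to packing such sets when their size is divisible by 3.

Cutting a chain at `c` produces pieces of every residue modulo 3, so five statements (`PackableOn`)
go through one induction on the size. Residue 0 packs completely. For residue 1 a vertex is left
out: any vertex of a nonseparable set, a suitable one of an end clique of a chain. For residue 2 one
vertex is left out at each end. Left-out neighbours of a separating vertex are then joined through
it into a path. `AttachOn` is the trace of claw-freeness left on an end clique by a vertex outside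
the set.

The hardest case is residue 2 in a nonseparable set (`chain_two_of_nonsep`). If deleting `r ∈ K`
leaves a cut vertex, the block `W` around `K' - r` is isolated, the rest forms two attachments `L`
and `M`, and their residues dictate the packing. When both are 1, a neighbour of `r` is left out in
place of `r`. -/

namespace SimpleGraph

variable {V : Type*} [DecidableEq V] {G : SimpleGraph V}
  {S T A B D₁ D₂ K K' L W M : Finset V} {c r v l m p : V}

/-! ### Vertex sets, cuts, chains and splittings into triples -/

/-- Among any three neighbours of a vertex, two are adjacent. -/
def NoClaw (G : SimpleGraph V) : Prop :=
  ∀ ⦃v a b c⦄, G.Adj v a → G.Adj v b → G.Adj v c → a ≠ b → a ≠ c → b ≠ c →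
    G.Adj a b ∨ G.Adj a c ∨ G.Adj b c

/-- The subgraph induced by `S` is preconnected, expressed through cuts. -/
def LinkedOn (G : SimpleGraph V) (S : Finset V) : Prop :=
  ∀ A ⊆ S, A.Nonempty → A ≠ S → ∃ a ∈ A, ∃ b ∈ S, b ∉ A ∧ G.Adj a b

/-- The subgraph induced by `S` is linked and has no cut vertex. -/
def NonsepOn (G : SimpleGraph V) (S : Finset V) : Prop :=
  G.LinkedOn S ∧ ∀ v ∈ S, G.LinkedOn (S.erase v)

/-- `S` can be partitioned into vertex sets of three-vertex paths. -/
inductive TripleSplit (G : SimpleGraph V) : Finset V → Prop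
  | empty : TripleSplit G ∅
  | cons {T : Finset V} {a b c : V} : G.Adj a b → G.Adj b c → a ≠ c → a ∉ T → b ∉ T → c ∉ T →
      TripleSplit G T → TripleSplit G (insert a (insert b (insert c T)))

/-- The neighbours of `v` in `S`. -/
noncomputable def nbr (G : SimpleGraph V) (S : Finset V) (v : V) : Finset V :=
  open Classical in S.filter (G.Adj v)

@[simp, grind =]
lemma mem_nbr {u : V} : u ∈ G.nbr S v ↔ u ∈ S ∧ G.Adj v u := by simp [nbr]

/-- The vertices of `K` are pairwise adjacent. -/
def CliqueOn (G : SimpleGraph V) (K : Finset V) : Prop :=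
  ∀ a ∈ K, ∀ b ∈ K, a ≠ b → G.Adj a b

/-- For `k ∈ K`, the neighbours of `k` in `S` outside `K` form a clique. -/
def AttachOn (G : SimpleGraph V) (S K : Finset V) : Prop :=
  ∀ k ∈ K, ∀ a ∈ S, ∀ b ∈ S, a ∉ K → b ∉ K → a ≠ b → G.Adj k a → G.Adj k b → G.Adj a b

/-- `S` is linked, and for every vertex `v` each component of `S - v` meets one of the cliques
`K`, `K'`. -/
structure ChainOn (G : SimpleGraph V) (S K K' : Finset V) : Prop where
  linked : G.LinkedOn S
  sub : K ⊆ S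
  sub' : K' ⊆ S
  ne : K.Nonempty
  ne' : K'.Nonempty
  clique : G.CliqueOn K
  clique' : G.CliqueOn K'
  comp : ∀ v ∈ S, ∀ D ⊆ S, v ∉ D → D.Nonempty →
    (∀ a ∈ D, ∀ b ∈ S, b ≠ v → b ∉ D → ¬ G.Adj a b) → ∃ d ∈ D, d ∈ K ∨ d ∈ K'

/-- `c` separates `S` into `A` and `B`. -/
structure CutOn (G : SimpleGraph V) (S A B : Finset V) (c : V) : Prop where
  eq : S = insert c (A ∪ B)
  notMemA : c ∉ A
  notMemB : c ∉ B
  disj : Disjoint A B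
  neA : A.Nonempty
  neB : B.Nonempty
  noAdj : ∀ a ∈ A, ∀ b ∈ B, ¬ G.Adj a b

lemma ChainOn.symm (h : G.ChainOn S K K') : G.ChainOn S K' K where
  linked := h.linked
  sub := h.sub'
  sub' := h.sub
  ne := h.ne'
  ne' := h.ne
  clique := h.clique'
  clique' := h.clique
  comp v hv D hD hvD hne hadj := by
    obtain ⟨d, hd, h'⟩ := h.comp v hv D hD hvD hne hadj
    exact ⟨d, hd, h'.symm⟩

lemma CutOn.symm (h : G.CutOn S A B c) : G.CutOn S B A c where
  eq := by rw [h.eq, Finset.union_comm]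
  notMemA := h.notMemB
  notMemB := h.notMemA
  disj := h.disj.symm
  neA := h.neB
  neB := h.neA
  noAdj a ha b hb hab := h.noAdj b hb a ha hab.symm

lemma CutOn.card_eq (h : G.CutOn S A B c) : S.card = A.card + B.card + 1 := by
  rw [h.eq, Finset.card_insert_of_notMem (by have := h.notMemA; have := h.notMemB; grind),
    Finset.card_union_of_disjoint h.disj]

lemma CutOn.card_insert (h : G.CutOn S A B c) : (insert c A).card = A.card + 1 :=
  Finset.card_insert_of_notMem h.notMemA

lemma TripleSplit.union (hA : G.TripleSplit A) (hB : G.TripleSplit B) (hd : Disjoint A B) :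
    G.TripleSplit (A ∪ B) := by
  rw [Finset.disjoint_left] at hd
  induction hA with
  | empty => simpa
  | @cons T a b c hab hbc hac ha hb hc hT ih =>
    rw [Finset.insert_union, Finset.insert_union, Finset.insert_union]
    exact .cons hab hbc hac (by grind) (by grind) (by grind) (ih (by grind))

lemma TripleSplit.union_eq (hA : G.TripleSplit A) (hB : G.TripleSplit B)
    (h : ∀ x, x ∈ S ↔ x ∈ A ∨ x ∈ B) (hd : ∀ x ∈ A, x ∉ B) : G.TripleSplit S := by
  have : S = A ∪ B := by ext; simp [h]
  rw [this]
  exact hA.union hB (Finset.disjoint_left.2 hd)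

lemma TripleSplit.insert_eq {T : Finset V} {a b c : V} (hT : G.TripleSplit T)
    (hab : G.Adj a b) (hbc : G.Adj b c) (hac : a ≠ c)
    (h : ∀ x, x ∈ S ↔ x = a ∨ x = b ∨ x = c ∨ x ∈ T) (ha : a ∉ T) (hb : b ∉ T) (hc : c ∉ T) :
    G.TripleSplit S := by
  have : S = insert a (insert b (insert c T)) := by ext; simp [h]
  rw [this]
  exact .cons hab hbc hac ha hb hc hT

lemma exists_cutOn (hS : G.LinkedOn S) (h : ¬ G.NonsepOn S) : ∃ c A B, G.CutOn S A B c := by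
  unfold NonsepOn at h
  push Not at h
  obtain ⟨c, hc, h⟩ := h hS
  unfold LinkedOn at h
  push Not at h
  obtain ⟨A, hA, hne, hAS, h⟩ := h
  refine ⟨c, A, S.erase c \ A, ?_, ?_, ?_, ?_, hne, ?_, ?_⟩
  · ext x; by_cases x = c <;> grind
  · grind
  · grind
  · exact Finset.disjoint_sdiff
  · rw [Finset.sdiff_nonempty]
    exact fun h' => hAS (hA.antisymm h')
  · intro a ha b hb
    exact h a ha b (by grind) (by grind)

lemma LinkedOn.insert {u : V} (hA : G.LinkedOn A) (hc : c ∉ A) (hu : u ∈ A)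
    (hcu : G.Adj c u) : G.LinkedOn (insert c A) := by
  intro D hD hne hDA
  by_cases hcD : c ∈ D
  · by_cases huD : u ∈ D
    · by_cases h : D.erase c = A
      · grind
      · obtain ⟨a, ha, b, hb, hbD, hab⟩ := hA (D.erase c) (by grind) ⟨u, by grind⟩ h
        exact ⟨a, by grind, b, by grind, by grind, hab⟩
    · exact ⟨c, hcD, u, by grind, huD, hcu⟩
  · by_cases h : D = A
    · exact ⟨u, by grind, c, by grind, hcD, hcu.symm⟩
    · obtain ⟨a, ha, b, hb, hbD, hab⟩ := hA D (by grind) hne h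
      exact ⟨a, ha, b, by grind, hbD, hab⟩

lemma AttachOn.mono {T K₁ : Finset V} (h : G.AttachOn S K) (hT : T ⊆ S) (hK : K₁ ⊆ K)
    (hK' : ∀ x ∈ T, x ∈ K → x ∈ K₁) : G.AttachOn T K₁ :=
  fun k hk a ha b hb haK hbK => h k (hK hk) a (hT ha) b (hT hb)
    (fun h => haK (hK' a ha h)) (fun h => hbK (hK' b hb h))

/-- With `v` as third leaf, non-adjacent `a` and `b` would complete a claw centred at `k`. -/
lemma NoClaw.attachOn_nbr (hG : G.NoClaw) (hv : v ∉ S) : G.AttachOn S (G.nbr S v) := by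
  intro k hk a ha b hb haK hbK hab hka hkb
  have := hG (mem_nbr.1 hk).2.symm hka hkb (by grind) (by grind) hab
  grind

/-! ### Cut vertices in claw-free sets and restriction of chains to a side -/

namespace CutOn

lemma exists_adj (h : G.CutOn S A B c) (hS : G.LinkedOn S) : ∃ a ∈ A, G.Adj c a := by
  obtain ⟨a, ha, b, hb, hbA, hab⟩ := hS A (by rw [h.eq]; grind) h.neA
    (by have := h.eq; have := h.notMemA; grind)
  have := h.noAdj a ha b
  have := h.eq
  exact ⟨a, ha, by grind [G.adj_comm]⟩

lemma nbr_nonempty (h : G.CutOn S A B c) (hS : G.LinkedOn S) : (G.nbr A c).Nonempty := by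
  obtain ⟨a, ha, hca⟩ := h.exists_adj hS
  exact ⟨a, by grind⟩

/-- A neighbour of `c` in `B` serves as the third leaf of a claw at `c`. -/
lemma clique_nbr (h : G.CutOn S A B c) (hG : G.NoClaw) (hS : G.LinkedOn S) :
    G.CliqueOn (G.nbr A c) := by
  intro a ha a' ha' hne
  obtain ⟨b, hb, hcb⟩ := h.symm.exists_adj hS
  have h1 := h.noAdj a (by grind) b hb
  have h2 := h.noAdj a' (by grind) b hb
  have hd := Finset.disjoint_left.1 h.disj
  have := hG (mem_nbr.1 ha).2 (mem_nbr.1 ha').2 hcb hne (by grind) (by grind)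
  grind

lemma linkedOn (h : G.CutOn S A B c) (hG : G.NoClaw) (hS : G.LinkedOn S) : G.LinkedOn A := by
  intro D hD hne hDA
  by_contra hcon
  push Not at hcon
  -- If `A` fell apart, both parts would be sides of `c`, so `c` would have a neighbour in each;
  -- `clique_nbr` makes these two adjacent.
  have hcut : G.CutOn S D (A \ D ∪ B) c := by
    have h1 := h.eq; have h2 := h.notMemA; have h3 := h.notMemB
    have h4 := Finset.disjoint_left.1 h.disj
    refine ⟨by ext; grind, by grind, by grind, Finset.disjoint_left.2 (by grind), hne, ?_, ?_⟩
    · exact h.neB.mono (by grind)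
    · intro a ha b hb
      rcases Finset.mem_union.1 hb with hb | hb
      · exact hcon a ha b (by grind) (by grind)
      · exact h.noAdj a (hD ha) b hb
  have hcut' : G.CutOn S (A \ D) (D ∪ B) c := by
    have h1 := h.eq; have h2 := h.notMemA; have h3 := h.notMemB
    have h4 := Finset.disjoint_left.1 h.disj
    refine ⟨by ext; grind, by grind, by grind, Finset.disjoint_left.2 (by grind), ?_, ?_, ?_⟩
    · rw [Finset.sdiff_nonempty]
      exact fun h' => hDA (hD.antisymm h')
    · exact h.neB.mono (by grind)
    · intro a ha b hb
      rcases Finset.mem_union.1 hb with hb | hb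
      · exact fun hab => hcon b hb a (by grind) (by grind) hab.symm
      · exact h.noAdj a (by grind) b hb
  obtain ⟨a, ha, hca⟩ := hcut.exists_adj hS
  obtain ⟨a', ha', hca'⟩ := hcut'.exists_adj hS
  have := h.clique_nbr hG hS a (by grind) a' (by grind) (by grind)
  exact hcon a ha a' (by grind) (by grind) this

lemma linkedOn_insert (h : G.CutOn S A B c) (hG : G.NoClaw) (hS : G.LinkedOn S) :
    G.LinkedOn (Insert.insert c A) := by
  obtain ⟨a, ha, hca⟩ := h.exists_adj hS
  exact (h.linkedOn hG hS).insert h.notMemA ha hca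

/-- A chain with a cut vertex: the two cliques lie on different sides. -/
lemma chain_sides (h : G.CutOn S A B c) (hC : G.ChainOn S K K') :
    (K ⊆ Insert.insert c A ∧ K' ⊆ Insert.insert c B ∧ (∃ k ∈ K, k ∈ A) ∧ ∃ k ∈ K', k ∈ B) ∨
    (K ⊆ Insert.insert c B ∧ K' ⊆ Insert.insert c A ∧ (∃ k ∈ K, k ∈ B) ∧ ∃ k ∈ K', k ∈ A) := by
  have h1 := h.eq; have h2 := h.notMemA; have h3 := h.notMemB
  have h4 := Finset.disjoint_left.1 h.disj
  obtain ⟨a, ha, haK⟩ := hC.comp c (by grind) A (by grind) h2 h.neA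
    (fun a ha b hb _ _ => h.noAdj a ha b (by grind))
  obtain ⟨b, hb, hbK⟩ := hC.comp c (by grind) B (by grind) h3 h.neB
    (fun a ha b hb _ _ hab => h.noAdj b (by grind) a ha hab.symm)
  have hno := h.noAdj
  have side : ∀ K : Finset V, K ⊆ S → G.CliqueOn K → ∀ a ∈ A, a ∈ K → K ⊆ Insert.insert c A := by
    intro K hKS hK a ha haK x hx
    by_contra hxA
    have hxB : x ∈ B := by grind
    exact hno a ha x hxB (hK a haK x hx (by grind))
  have side' : ∀ K : Finset V, K ⊆ S → G.CliqueOn K → ∀ a ∈ B, a ∈ K → K ⊆ Insert.insert c B := by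
    intro K hKS hK a ha haK x hx
    by_contra hxA
    have hxB : x ∈ A := by grind
    exact hno x hxB a ha (hK x hx a haK (by grind))
  have k1 := side K hC.sub hC.clique
  have k2 := side' K hC.sub hC.clique
  have k3 := side K' hC.sub' hC.clique'
  have k4 := side' K' hC.sub' hC.clique'
  rcases haK with haK | haK
  · left
    have := k1 a ha haK
    have hbK' : b ∈ K' := by grind
    exact ⟨this, k4 b hb hbK', ⟨a, haK, ha⟩, b, hbK', hb⟩
  · right
    have := k3 a ha haK
    have hbK' : b ∈ K := by grind
    exact ⟨k2 b hb hbK', this, ⟨b, hbK', hb⟩, a, haK, ha⟩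

/-- A component of `A - v` that avoids the neighbours of `c` is already a component of `S - v`. It
meets `K` or `K'`, and `K'` lies on the other side. -/
lemma chain_left (h : G.CutOn S A B c) (hG : G.NoClaw) (hC : G.ChainOn S K K')
    (hK : ∃ k ∈ K, k ∈ A) (hK' : K' ⊆ Insert.insert c B) :
    G.ChainOn A (K ∩ A) (G.nbr A c) where
  linked := h.linkedOn hG hC.linked
  sub := by grind
  sub' := by grind
  ne := by obtain ⟨k, hk, hkA⟩ := hK; exact ⟨k, by grind⟩
  ne' := h.nbr_nonempty hC.linked
  clique a ha b hb := hC.clique a (by grind) b (by grind)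
  clique' := h.clique_nbr hG hC.linked
  comp v hv D hD hvD hne hadj := by
    have h1 := h.eq; have h2 := h.notMemA; have h3 := h.notMemB
    have h4 := Finset.disjoint_left.1 h.disj
    by_contra hcon
    push Not at hcon
    obtain ⟨d, hd, hdK⟩ := hC.comp v (by grind) D (by grind) hvD hne (by
      intro a ha b hb hbv hbD hab
      by_cases hbc : b = c
      · have := (hcon a ha).2
        grind [G.adj_comm]
      · by_cases hbA : b ∈ A
        · exact hadj a ha b hbA hbv hbD hab
        · exact h.noAdj a (hD ha) b (by grind) hab)
    grind

lemma chain_left_insert (h : G.CutOn S A B c) (hG : G.NoClaw) (hC : G.ChainOn S K K')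
    (hKA : K ⊆ Insert.insert c A) (hK' : K' ⊆ Insert.insert c B) :
    G.ChainOn (Insert.insert c A) K {c} where
  linked := h.linkedOn_insert hG hC.linked
  sub := hKA
  sub' := by grind
  ne := hC.ne
  ne' := by simp
  clique := hC.clique
  clique' := by intro; grind
  comp v hv D hD hvD hne hadj := by
    have h1 := h.eq; have h2 := h.notMemA; have h3 := h.notMemB
    have h4 := Finset.disjoint_left.1 h.disj
    by_contra hcon
    push Not at hcon
    obtain ⟨d, hd, hdK⟩ := hC.comp v (by grind) D (by grind) hvD hne (by
      intro a ha b hb hbv hbD hab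
      by_cases hbA : b ∈ Insert.insert c A
      · exact hadj a ha b hbA hbv hbD hab
      · exact h.noAdj a (by grind) b (by grind) hab)
    grind

end CutOn

/-! ### The induction statements and separating pairs -/

/-- The packing statements for a vertex set `S`, proved together by induction on its size. -/
structure PackableOn (G : SimpleGraph V) (S : Finset V) : Prop where
  nonsep_zero : G.NonsepOn S → S.card % 3 = 0 → G.TripleSplit S
  nonsep_one : G.NonsepOn S → S.card % 3 = 1 → ∀ r ∈ S, G.TripleSplit (S.erase r)
  chain_zero : ∀ K K', G.ChainOn S K K' → S.card % 3 = 0 → G.TripleSplit S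
  chain_one : ∀ K K', G.ChainOn S K K' → G.AttachOn S K → S.card % 3 = 1 →
    ∃ r ∈ K, G.TripleSplit (S.erase r)
  chain_two : ∀ K K', G.ChainOn S K K' → G.AttachOn S K → G.AttachOn S K' → S.card % 3 = 2 →
    ∃ r ∈ K, ∃ r' ∈ K', r ≠ r' ∧ G.TripleSplit ((S.erase r).erase r')

namespace CutOn

/-- Interchange of the two vertices of a separating pair. -/
lemma swap (h : G.CutOn (S.erase r) A B c) (hr : r ∈ S) : G.CutOn (S.erase c) A B r := by
  have h1 := h.eq; have h2 := h.notMemA; have h3 := h.notMemB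
  have hrS : r ∉ S.erase r := by grind
  refine ⟨?_, by grind, by grind, h.disj, h.neA, h.neB, h.noAdj⟩
  ext x
  have : x ∈ S.erase r ↔ x ∈ Insert.insert c (A ∪ B) := by rw [h1]
  by_cases x = r <;> by_cases x = c <;> grind

lemma mem_of_erase (h : G.CutOn (S.erase r) A B c) : c ∈ S ∧ c ≠ r := by
  have : c ∈ S.erase r := by rw [h.eq]; grind
  grind

lemma chain_erase (h : G.CutOn (S.erase r) A B c) (hG : G.NoClaw) (hS : G.NonsepOn S)
    (hr : r ∈ S) : G.ChainOn (S.erase r) (G.nbr A r) (G.nbr B r) := by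
  have hc := h.mem_of_erase
  have hs := h.swap hr
  have h1 := h.eq
  refine ⟨hS.2 r hr, by grind, by grind, hs.nbr_nonempty (hS.2 c hc.1),
    hs.symm.nbr_nonempty (hS.2 c hc.1), hs.clique_nbr hG (hS.2 c hc.1),
    hs.symm.clique_nbr hG (hS.2 c hc.1), ?_⟩
  intro v hv D hD hvD hne hadj
  by_contra hcon
  push Not at hcon
  -- `S - v` is linked, so `D` has an edge to `r`; its end in `D` avoids `A` and `B` and can only be
  -- `c`.
  have hcr : c ∈ D ∧ G.Adj c r := by
    obtain ⟨a, ha, b, hb, hbD, hab⟩ := hS.2 v (by grind) D (by grind) hne (by grind)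
    have hbr : b = r := by
      by_contra hbr
      exact hadj a ha b (by grind) (by grind) hbD hab
    have := hcon a ha
    have : a = c := by grind [G.adj_comm]
    grind
  -- the side of `c` not containing `v` lies in `D`
  have key : ∀ A B, G.CutOn (S.erase r) A B c → v ∉ A → (∀ d ∈ D, d ∉ G.nbr A r) → False := by
    intro A B h hvA hcon
    have h1 := h.eq; have h2 := h.notMemA; have h3 := h.notMemB
    obtain ⟨x, hxA, hrx⟩ := (h.swap hr).exists_adj (hS.2 c hc.1)
    obtain ⟨y, hyA, hcy⟩ := h.exists_adj (hS.2 r hr)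
    have hyD : y ∈ D := by
      by_contra hyD
      exact hadj c hcr.1 y (by grind) (by grind) hyD hcy
    have hAD : D ∩ A = A := by
      by_contra hne
      obtain ⟨a, ha, b, hb, hbD, hab⟩ :=
        h.linkedOn hG (hS.2 r hr) (D ∩ A) (by grind) ⟨y, by grind⟩ hne
      exact hadj a (by grind) b (by grind) (by grind) (by grind) hab
    exact hcon x (by grind) (by grind)
  by_cases hvA : v ∈ A
  · exact key B A h.symm (by have := Finset.disjoint_left.1 h.disj; grind) (by grind)
  · exact key A B h hvA (by grind)

/-- The side `A` of a separating pair `r`, `c` is a chain between the neighbours of `r` and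
those of `c`. -/
lemma chain_side (h : G.CutOn (S.erase r) A B c) (hG : G.NoClaw) (hS : G.NonsepOn S)
    (hr : r ∈ S) : G.ChainOn A (G.nbr A r) (G.nbr A c) := by
  have hc := h.chain_erase hG hS hr
  obtain ⟨k, hk⟩ := hc.ne
  have := h.chain_left hG hc ⟨k, hk, by grind⟩ (by grind)
  rwa [Finset.inter_eq_left.2 (by grind)] at this

lemma chain_side_insert (h : G.CutOn (S.erase r) A B c) (hG : G.NoClaw) (hS : G.NonsepOn S)
    (hr : r ∈ S) : G.ChainOn (Insert.insert c A) (G.nbr A r) {c} :=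
  h.chain_left_insert hG (h.chain_erase hG hS hr) (by grind) (by grind)

lemma attachOn_nbr_left (h : G.CutOn (S.erase r) A B c) (hG : G.NoClaw) :
    G.AttachOn A (G.nbr A r) := by
  refine hG.attachOn_nbr ?_
  have := h.eq
  have : r ∉ S.erase r := by grind
  grind

lemma attachOn_nbr_right (h : G.CutOn (S.erase r) A B c) (hG : G.NoClaw) :
    G.AttachOn A (G.nbr A c) :=
  hG.attachOn_nbr h.notMemA

/-- Without the edge `rc`, the neighbours of `r` in `A` are all its neighbours in `A` together with
`c`. -/
lemma attachOn_nbr_insert (h : G.CutOn (S.erase r) A B c) (hG : G.NoClaw) (hrc : ¬ G.Adj r c) :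
    G.AttachOn (Insert.insert c A) (G.nbr A r) := by
  have : G.nbr A r = G.nbr (Insert.insert c A) r := by ext; grind
  rw [this]
  refine hG.attachOn_nbr ?_
  have := h.eq
  have := h.mem_of_erase
  have : r ∉ S.erase r := by grind
  grind

end CutOn

/-! ### Nonseparable sets of size 1 and 0 modulo 3 -/

section induction

variable (hG : G.NoClaw) (ih : ∀ T : Finset V, T.card < S.card → G.PackableOn T)
include hG ih

lemma tripleSplit_erase_of_nonsep (hS : G.NonsepOn S) (hcard : S.card % 3 = 1) (hr : r ∈ S) :
    G.TripleSplit (S.erase r) := by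
  have hlt := Finset.card_erase_add_one hr
  have ih' := ih (S.erase r) (by omega)
  by_cases h : G.NonsepOn (S.erase r)
  · exact ih'.nonsep_zero h (by omega)
  · obtain ⟨c, A, B, hc⟩ := exists_cutOn (hS.2 r hr) h
    exact ih'.chain_zero _ _ (hc.chain_erase hG hS hr) (by omega)

end induction

/-- In a nonseparable set of size `2` modulo `3`, if deleting `r` leaves a cut vertex, then some
neighbour of `r` can be deleted as well. -/
lemma exists_nbr_tripleSplit (hG : G.NoClaw)
    (ih : ∀ T : Finset V, T.card < S.card → G.PackableOn T) (hS : G.NonsepOn S) (hr : r ∈ S)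
    (hcard : S.card % 3 = 2) (hc : G.CutOn (S.erase r) A B c) :
    ∃ s ∈ S.erase r, G.Adj r s ∧ G.TripleSplit ((S.erase r).erase s) := by
  have hlt := Finset.card_erase_add_one hr
  have h0 := hc.card_eq
  have hA := hc.card_insert
  have hB := hc.symm.card_insert
  have hm := hc.mem_of_erase
  have main : ∀ A B, G.CutOn (S.erase r) A B c → (insert c A).card = A.card + 1 →
      (insert c B).card = B.card + 1 → (S.erase r).card = A.card + B.card + 1 →
      A.card % 3 = 1 → ∃ s ∈ S.erase r, G.Adj r s ∧ G.TripleSplit ((S.erase r).erase s) := by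
    intro A B hc hA hB h0 h1
    have e1 := hc.eq; have e2 := hc.notMemA; have e3 := hc.notMemB
    have e4 := Finset.disjoint_left.1 hc.disj
    have := hc.neA.card_pos
    have := hc.neB.card_pos
    obtain ⟨s, hs, hsA⟩ := (ih A (by omega)).chain_one _ _ (hc.chain_side hG hS hr)
      (hc.attachOn_nbr_left hG) h1
    have hB' := (ih (insert c B) (by omega)).chain_zero _ _
      (hc.symm.chain_side_insert hG hS hr) (by omega)
    exact ⟨s, by grind, by grind, hsA.union_eq hB' (by rw [e1]; grind) (by grind)⟩
  have := hc.neA.card_pos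
  have := hc.neB.card_pos
  -- Here `|S| = |A| + |B| + 2`, so `|A| + |B|` is divisible by 3.
  have : A.card % 3 = 1 ∨ B.card % 3 = 1 ∨ A.card % 3 = 0 ∧ B.card % 3 = 0 := by omega
  rcases this with h | h | ⟨h, h'⟩
  · exact main A B hc hA hB h0 h
  · exact main B A hc.symm hB hA (by omega) h
  · have e1 := hc.eq; have e2 := hc.notMemA; have e3 := hc.notMemB
    have e4 := Finset.disjoint_left.1 hc.disj
    have hB' := (ih B (by omega)).chain_zero _ _ (hc.symm.chain_side hG hS hr) h'
    by_cases hrc : G.Adj r c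
    · have hA' := (ih A (by omega)).chain_zero _ _ (hc.chain_side hG hS hr) h
      exact ⟨c, by grind, hrc, hA'.union_eq hB' (by rw [e1]; grind) (by grind)⟩
    · obtain ⟨s, hs, hsA⟩ := (ih (insert c A) (by omega)).chain_one _ _
        (hc.chain_side_insert hG hS hr) (hc.attachOn_nbr_insert hG hrc) (by omega)
      exact ⟨s, by grind, by grind, hsA.union_eq hB' (by rw [e1]; grind) (by grind)⟩

/-- In a nonseparable set of size divisible by `3`, if deleting `r` leaves a cut vertex, then `r`
can be completed to a three-vertex path by two of its neighbours. -/
lemma tripleSplit_of_cutOn_erase (hG : G.NoClaw)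
    (ih : ∀ T : Finset V, T.card < S.card → G.PackableOn T) (hS : G.NonsepOn S) (hr : r ∈ S)
    (hcard : S.card % 3 = 0) (hc : G.CutOn (S.erase r) A B c) : G.TripleSplit S := by
  have hlt := Finset.card_erase_add_one hr
  have h0 := hc.card_eq
  have hm := hc.mem_of_erase
  have main : ∀ A B, G.CutOn (S.erase r) A B c → A.card % 3 = 1 → G.TripleSplit S := by
    intro A B hc h1
    have h0 := hc.card_eq
    have hB := hc.symm.card_insert
    have e1 := hc.eq; have e2 := hc.notMemA; have e3 := hc.notMemB
    have e4 := Finset.disjoint_left.1 hc.disj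
    have e5 : ∀ x, x ∈ S ↔ x = r ∨ x = c ∨ x ∈ A ∨ x ∈ B := by
      intro x
      have : x ∈ S.erase r ↔ x ∈ insert c (A ∪ B) := by rw [e1]
      grind
    have e6 : r ∉ A ∧ r ∉ B := by
      have : r ∉ S.erase r := by grind
      grind
    have := hc.neA.card_pos
    have := hc.neB.card_pos
    obtain ⟨s, hs, hsA⟩ := (ih A (by omega)).chain_one _ _ (hc.chain_side hG hS hr)
      (hc.attachOn_nbr_left hG) h1
    have hrs := (mem_nbr.1 hs).2.symm
    -- Now `|B|` is divisible by 3. The path `s, r, c` uses up `c` if `r` and `c` are adjacent;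
    -- otherwise `c` joins `B` and the path is `s, r, t` with `t ∈ B`.
    by_cases hrc : G.Adj r c
    · have hB' := (ih B (by omega)).chain_zero _ _ (hc.symm.chain_side hG hS hr) (by omega)
      exact (hsA.union hB' (Finset.disjoint_left.2 (by grind))).insert_eq hrs hrc (by grind)
        (by grind) (by grind) (by grind) (by grind)
    · obtain ⟨t, ht, htB⟩ := (ih (insert c B) (by omega)).chain_one _ _
        (hc.symm.chain_side_insert hG hS hr) (hc.symm.attachOn_nbr_insert hG hrc) (by omega)
      exact (hsA.union htB (Finset.disjoint_left.2 (by grind))).insert_eq hrs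
        (mem_nbr.1 ht).2 (by grind) (by grind) (by grind) (by grind) (by grind)
  have := hc.neA.card_pos
  have := hc.neB.card_pos
  have : A.card % 3 = 1 ∨ B.card % 3 = 1 ∨ A.card % 3 = 2 ∧ B.card % 3 = 2 := by omega
  rcases this with h | h | ⟨h, h'⟩
  · exact main A B hc h
  · exact main B A hc.symm h
  · have e1 := hc.eq; have e2 := hc.notMemA; have e3 := hc.notMemB
    have e4 := Finset.disjoint_left.1 hc.disj
    have e5 : ∀ x, x ∈ S ↔ x = r ∨ x = c ∨ x ∈ A ∨ x ∈ B := by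
      intro x
      have : x ∈ S.erase r ↔ x ∈ insert c (A ∪ B) := by rw [e1]
      grind
    have e6 : r ∉ A ∧ r ∉ B := by
      have : r ∉ S.erase r := by grind
      grind
    obtain ⟨a, ha, a', ha', hne, hA⟩ := (ih A (by omega)).chain_two _ _
      (hc.chain_side hG hS hr) (hc.attachOn_nbr_left hG) (hc.attachOn_nbr_right hG) h
    obtain ⟨b, hb, b', hb', hne', hB⟩ := (ih B (by omega)).chain_two _ _
      (hc.symm.chain_side hG hS hr) (hc.symm.attachOn_nbr_left hG)
      (hc.symm.attachOn_nbr_right hG) h'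
    rw [mem_nbr] at ha ha' hb hb'
    -- With both sides of residue 2, the separating vertices become the middles of two paths `a', c,
    -- b'` and `a, r, b` from `A` to `B`.
    have h3 := (hA.union hB (Finset.disjoint_left.2 (by grind))).insert_eq ha'.2.symm hb'.2
      (by grind) (by grind) (by grind) (by grind) (by grind)
      (S := insert a' (insert c (insert b' ((A.erase a).erase a' ∪ (B.erase b).erase b'))))
    exact h3.insert_eq ha.2.symm hb.2 (by grind) (by grind) (by grind) (by grind) (by grind)

/-- Suppose `S - r` is nonseparable and `s` is a neighbour of `r`. If deleting `s` too leaves a cut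
vertex, `exists_nbr_tripleSplit` extends `r, s` by a neighbour of `s`. Otherwise the rest is
nonseparable of residue 1, and any third vertex attached to `r` or `s` will do. -/
lemma tripleSplit_of_nonsep (hG : G.NoClaw)
    (ih : ∀ T : Finset V, T.card < S.card → G.PackableOn T) (hS : G.NonsepOn S)
    (hcard : S.card % 3 = 0) : G.TripleSplit S := by
  rcases S.eq_empty_or_nonempty with rfl | ⟨r, hr⟩
  · exact .empty
  have hlt := Finset.card_erase_add_one hr
  by_cases h1 : G.NonsepOn (S.erase r)
  swap
  · obtain ⟨c, A, B, hc⟩ := exists_cutOn (hS.2 r hr) h1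
    exact tripleSplit_of_cutOn_erase hG ih hS hr hcard hc
  obtain ⟨a, ha, s, hs, hsa, hrs⟩ := hS.1 {r} (by grind) (by simp) (by
    intro h; rw [← h] at hcard; simp at hcard)
  obtain rfl : a = r := by grind
  have hs1 : s ∈ S.erase a := by grind
  have hlt' := Finset.card_erase_add_one hs1
  by_cases h2 : G.NonsepOn ((S.erase a).erase s)
  swap
  · obtain ⟨c, A, B, hc⟩ := exists_cutOn (h1.2 s hs1) h2
    obtain ⟨t, ht, hst, hT⟩ := exists_nbr_tripleSplit hG (fun T hT => ih T (by omega)) h1 hs1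
      (by omega) hc
    exact hT.insert_eq hrs hst (by grind) (by grind) (by grind) (by grind) (by grind)
  · have hne : ({a, s} : Finset V) ≠ S := by
      intro h
      have : S.card = 2 := by rw [← h, Finset.card_pair (by grind)]
      omega
    obtain ⟨u, hu, t, ht, htu, hut⟩ := hS.1 {a, s} (by grind) (by simp) hne
    have hT := (ih ((S.erase a).erase s) (by omega)).nonsep_one h2 (by omega) t (by grind)
    have : u = a ∨ u = s := by grind
    rcases this with rfl | rfl
    · exact hT.insert_eq hrs.symm hut (by grind) (by grind) (by grind) (by grind) (by grind)
    · exact hT.insert_eq hrs hut (by grind) (by grind) (by grind) (by grind) (by grind)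

lemma LinkedOn.exists_adj (hS : G.LinkedOn S) (hv : v ∈ S) (hcard : 2 ≤ S.card) :
    ∃ t ∈ S, G.Adj v t := by
  obtain ⟨a, ha, t, ht, -, hat⟩ := hS {v} (by grind) (by simp) (by
    intro h; rw [← h] at hcard; simp at hcard)
  obtain rfl : a = v := by grind
  exact ⟨t, ht, hat⟩

lemma NonsepOn.exists_adj_ne (hS : G.NonsepOn S) (hv : v ∈ S) (hcard : 3 ≤ S.card) {u : V}
    (hu : u ≠ v) : ∃ t ∈ S, t ≠ u ∧ G.Adj v t := by
  by_cases huS : u ∈ S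
  · have := Finset.card_erase_add_one huS
    obtain ⟨t, ht, hvt⟩ := (hS.2 u huS).exists_adj (v := v) (by grind) (by omega)
    exact ⟨t, by grind, by grind, hvt⟩
  · obtain ⟨t, ht, hvt⟩ := hS.1.exists_adj hv (by omega)
    exact ⟨t, ht, by grind, hvt⟩

/-- A cut of `S - v - u` could be crossed in `S - u` only through `v`, and the neighbours of `v` on
its two sides are adjacent. -/
lemma NonsepOn.erase_of_clique (hS : G.NonsepOn S) (hv : v ∈ S) (hK : G.CliqueOn (G.nbr S v)) :
    G.NonsepOn (S.erase v) := by
  refine ⟨hS.2 v hv, fun u hu D hD hne hDS => ?_⟩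
  by_contra hcon
  push Not at hcon
  have hu' : u ∈ S := by grind
  obtain ⟨a, ha, b, hb, hbD, hab⟩ := hS.2 u hu' D (by grind) hne (by grind)
  obtain rfl : b = v := by
    by_contra hbv
    exact hcon a ha b (by grind) hbD hab
  obtain ⟨a', ha', b', hb', hbD', hab'⟩ := hS.2 u hu' (((S.erase b).erase u) \ D) (by grind)
    (by rw [Finset.sdiff_nonempty]; exact fun h => hDS (hD.antisymm h)) (by grind)
  obtain rfl : b' = b := by
    by_contra hbv
    exact hcon b' (by grind) a' (by grind) (by grind) hab'.symm
  have := hK a (by grind [G.adj_comm]) a' (by grind [G.adj_comm]) (by grind)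
  exact hcon a ha a' (by grind) (by grind) this

/-- `S - v` is linked, so its only component is `S - v` itself; `h` guarantees that it meets one of
the cliques. -/
lemma NonsepOn.chainOn (hS : G.NonsepOn S) (hK : K ⊆ S) (hK' : K' ⊆ S) (hne : K.Nonempty)
    (hne' : K'.Nonempty) (hcl : G.CliqueOn K) (hcl' : G.CliqueOn K')
    (h : ∀ v, ∃ x, (x ∈ K ∨ x ∈ K') ∧ x ≠ v) : G.ChainOn S K K' where
  linked := hS.1
  sub := hK
  sub' := hK'
  ne := hne
  ne' := hne'
  clique := hcl
  clique' := hcl'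
  comp v hv D hD hvD hneD hadj := by
    obtain ⟨x, hx, hxv⟩ := h v
    refine ⟨x, ?_, hx⟩
    by_contra hxD
    obtain ⟨a, ha, b, hb, hbD, hab⟩ := hS.2 v hv D (by grind) hneD (by grind)
    exact hadj a ha b (by grind) (by grind) hbD hab

/-! ### Chains with a cut vertex -/

section cut

variable (hG : G.NoClaw) (ih : ∀ T : Finset V, T.card < S.card → G.PackableOn T)
include hG ih

/-- As in the next two lemmas, the residues of `|A|` and `|B|` decide whether `c` joins one side or
becomes the middle of a path with one end in each side. -/
lemma chain_zero_of_cutOn (hc : G.CutOn S A B c) (hC : G.ChainOn S K K')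
    (hcard : S.card % 3 = 0) : G.TripleSplit S := by
  have main : ∀ A B K K', G.CutOn S A B c → G.ChainOn S K K' → K ⊆ insert c A →
      K' ⊆ insert c B → (∃ k ∈ K, k ∈ A) → (∃ k ∈ K', k ∈ B) → A.card % 3 ≠ 2 →
      G.TripleSplit S := by
    intro A B K K' hc hC hKA hKB hA hB h2
    have h0 := hc.card_eq
    have h1 := hc.symm.card_insert
    have e1 := hc.eq; have e2 := hc.notMemA; have e3 := hc.notMemB
    have e4 := Finset.disjoint_left.1 hc.disj
    have := hc.neA.card_pos
    have := hc.neB.card_pos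
    have hCA := hc.chain_left hG hC hA hKB
    have hCB := hc.symm.chain_left hG hC.symm hB hKA
    have : A.card % 3 = 0 ∨ A.card % 3 = 1 := by omega
    rcases this with h | h
    · have hA := (ih A (by omega)).chain_zero _ _ hCA h
      have hB := (ih (insert c B) (by omega)).chain_zero _ _
        (hc.symm.chain_left_insert hG hC.symm hKB hKA) (by omega)
      exact hA.union_eq hB (by grind) (by grind)
    · obtain ⟨a, ha, hTA⟩ := (ih A (by omega)).chain_one _ _ hCA.symm
        (hG.attachOn_nbr hc.notMemA) h
      obtain ⟨b, hb, hTB⟩ := (ih B (by omega)).chain_one _ _ hCB.symm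
        (hG.attachOn_nbr hc.notMemB) (by omega)
      rw [mem_nbr] at ha hb
      exact (hTA.union hTB (Finset.disjoint_left.2 (by grind))).insert_eq ha.2.symm hb.2
        (by grind) (by grind) (by grind) (by grind) (by grind)
  have h0 := hc.card_eq
  rcases hc.chain_sides hC with ⟨h1, h2, h3, h4⟩ | ⟨h1, h2, h3, h4⟩ <;>
  by_cases h : A.card % 3 = 2
  · exact main B A K' K hc.symm hC.symm h2 h1 h4 h3 (by omega)
  · exact main A B K K' hc hC h1 h2 h3 h4 h
  · exact main B A K K' hc.symm hC h1 h2 h3 h4 (by omega)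
  · exact main A B K' K hc hC.symm h2 h1 h4 h3 h

lemma chain_one_of_cutOn (hc : G.CutOn S A B c) (hC : G.ChainOn S K K')
    (hatt : G.AttachOn S K) (hcard : S.card % 3 = 1) :
    ∃ r ∈ K, G.TripleSplit (S.erase r) := by
  have main : ∀ A B, G.CutOn S A B c → K ⊆ insert c A →
      K' ⊆ insert c B → (∃ k ∈ K, k ∈ A) → (∃ k ∈ K', k ∈ B) →
      ∃ r ∈ K, G.TripleSplit (S.erase r) := by
    intro A B hc hKA hKB hA hB
    have h0 := hc.card_eq
    have h1 := hc.card_insert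
    have h1' := hc.symm.card_insert
    have e1 := hc.eq; have e2 := hc.notMemA; have e3 := hc.notMemB
    have e4 := Finset.disjoint_left.1 hc.disj
    have := hc.neA.card_pos
    have := hc.neB.card_pos
    have hCA := hc.chain_left hG hC hA hKB
    have hCB := hc.symm.chain_left hG hC.symm hB hKA
    have hattA : G.AttachOn A (K ∩ A) := hatt.mono (by grind) (by grind) (by grind)
    have : A.card % 3 = 0 ∨ A.card % 3 = 1 ∨ A.card % 3 = 2 := by omega
    rcases this with h | h | h
    · have hTB := (ih B (by omega)).chain_zero _ _ hCB (by omega)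
      obtain ⟨a, ha, hTA⟩ := (ih (insert c A) (by omega)).chain_one _ _
        (hc.chain_left_insert hG hC hKA hKB) (hatt.mono (by grind) (by grind) (by grind))
        (by omega)
      exact ⟨a, ha, hTA.union_eq hTB (by grind) (by grind)⟩
    · obtain ⟨a, ha, hTA⟩ := (ih A (by omega)).chain_one _ _ hCA hattA h
      have hTB := (ih (insert c B) (by omega)).chain_zero _ _
        (hc.symm.chain_left_insert hG hC.symm hKB hKA) (by omega)
      exact ⟨a, by grind, hTA.union_eq hTB (by grind) (by grind)⟩
    · obtain ⟨a, ha, z, hz, haz, hTA⟩ := (ih A (by omega)).chain_two _ _ hCA hattA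
        (hG.attachOn_nbr hc.notMemA) h
      obtain ⟨b, hb, hTB⟩ := (ih B (by omega)).chain_one _ _ hCB.symm
        (hG.attachOn_nbr hc.notMemB) (by omega)
      rw [mem_nbr] at hz hb
      exact ⟨a, by grind, (hTA.union hTB (Finset.disjoint_left.2 (by grind))).insert_eq
        hz.2.symm hb.2 (by grind) (by grind) (by grind) (by grind) (by grind)⟩
  rcases hc.chain_sides hC with ⟨h1, h2, h3, h4⟩ | ⟨h1, h2, h3, h4⟩
  · exact main A B hc h1 h2 h3 h4
  · exact main B A hc.symm h1 h2 h3 h4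

lemma chain_two_of_cutOn (hc : G.CutOn S A B c) (hC : G.ChainOn S K K')
    (hatt : G.AttachOn S K) (hatt' : G.AttachOn S K') (hcard : S.card % 3 = 2) :
    ∃ r ∈ K, ∃ r' ∈ K', r ≠ r' ∧ G.TripleSplit ((S.erase r).erase r') := by
  have main : ∀ A B K K', G.CutOn S A B c → G.ChainOn S K K' → G.AttachOn S K →
      G.AttachOn S K' → K ⊆ insert c A →
      K' ⊆ insert c B → (∃ k ∈ K, k ∈ A) → (∃ k ∈ K', k ∈ B) → A.card % 3 ≠ 0 →
      ∃ r ∈ K, ∃ r' ∈ K', r ≠ r' ∧ G.TripleSplit ((S.erase r).erase r') := by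
    intro A B K K' hc hC hatt hatt' hKA hKB hA hB h2
    have h0 := hc.card_eq
    have h1 := hc.symm.card_insert
    have e1 := hc.eq; have e2 := hc.notMemA; have e3 := hc.notMemB
    have e4 := Finset.disjoint_left.1 hc.disj
    have := hc.neA.card_pos
    have := hc.neB.card_pos
    have hCA := hc.chain_left hG hC hA hKB
    have hCB := hc.symm.chain_left hG hC.symm hB hKA
    have hattA : G.AttachOn A (K ∩ A) := hatt.mono (by grind) (by grind) (by grind)
    have hattB : G.AttachOn B (K' ∩ B) := hatt'.mono (by grind) (by grind) (by grind)
    have : A.card % 3 = 1 ∨ A.card % 3 = 2 := by omega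
    rcases this with h | h
    · obtain ⟨a, ha, hTA⟩ := (ih A (by omega)).chain_one _ _ hCA hattA h
      obtain ⟨b, hb, hTB⟩ := (ih (insert c B) (by omega)).chain_one _ _
        (hc.symm.chain_left_insert hG hC.symm hKB hKA)
        (hatt'.mono (by grind) (by grind) (by grind)) (by omega)
      exact ⟨a, by grind, b, hb, by grind, hTA.union_eq hTB (by grind) (by grind)⟩
    · obtain ⟨a, ha, z, hz, haz, hTA⟩ := (ih A (by omega)).chain_two _ _ hCA hattA
        (hG.attachOn_nbr hc.notMemA) h
      obtain ⟨b, hb, z', hz', hbz, hTB⟩ := (ih B (by omega)).chain_two _ _ hCB hattB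
        (hG.attachOn_nbr hc.notMemB) (by omega)
      rw [mem_nbr] at hz hz'
      exact ⟨a, by grind, b, by grind, by grind,
        (hTA.union hTB (Finset.disjoint_left.2 (by grind))).insert_eq
        hz.2.symm hz'.2 (by grind) (by grind) (by grind) (by grind) (by grind)⟩
  have h0 := hc.card_eq
  have conv : (∃ r ∈ K', ∃ r' ∈ K, r ≠ r' ∧ G.TripleSplit ((S.erase r).erase r')) →
      ∃ r ∈ K, ∃ r' ∈ K', r ≠ r' ∧ G.TripleSplit ((S.erase r).erase r') := by
    rintro ⟨r, hr, r', hr', hne, hT⟩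
    exact ⟨r', hr', r, hr, hne.symm, by rwa [Finset.erase_right_comm]⟩
  rcases hc.chain_sides hC with ⟨h1, h2, h3, h4⟩ | ⟨h1, h2, h3, h4⟩ <;>
  by_cases h : A.card % 3 = 0
  · exact conv (main B A K' K hc.symm hC.symm hatt' hatt h2 h1 h4 h3 (by omega))
  · exact main A B K K' hc hC hatt hatt' h1 h2 h3 h4 h
  · exact main B A K K' hc.symm hC hatt hatt' h1 h2 h3 h4 (by omega)
  · exact conv (main A B K' K hc hC.symm hatt' hatt h2 h1 h4 h3 h)

end cut

/-! ### Isolating the block that contains a clique -/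

/-- A partition of `S` into `L`, `W`, `M`, where `L` and `M` are attached to the rest only through
the vertices `l` and `m` of `W`. The sets `L` and `M` may be empty. -/
structure BrickOn (G : SimpleGraph V) (S L W M : Finset V) (l m : V) : Prop where
  mem_iff : ∀ x, x ∈ S ↔ x ∈ L ∨ x ∈ W ∨ x ∈ M
  disjLW : ∀ x ∈ L, x ∉ W
  disjLM : ∀ x ∈ L, x ∉ M
  disjMW : ∀ x ∈ M, x ∉ W
  memL : l ∈ W
  memM : m ∈ W
  ne : l ≠ m
  noAdj : ∀ a ∈ L, ∀ b ∈ M, ¬ G.Adj a b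
  adjL : ∀ a ∈ L, ∀ b ∈ W, G.Adj a b → b = l
  adjM : ∀ a ∈ M, ∀ b ∈ W, G.Adj a b → b = m

namespace BrickOn

lemma symm (b : G.BrickOn S L W M l m) : G.BrickOn S M W L m l where
  mem_iff x := by rw [b.mem_iff]; tauto
  disjLW := b.disjMW
  disjLM x hx hx' := b.disjLM x hx' hx
  disjMW := b.disjLW
  memL := b.memM
  memM := b.memL
  ne := b.ne.symm
  noAdj x hx y hy h := b.noAdj y hy x hx h.symm
  adjL := b.adjM
  adjM := b.adjL

lemma card_eq (b : G.BrickOn S L W M l m) : S.card = L.card + W.card + M.card := by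
  have : S = L ∪ W ∪ M := by ext x; rw [b.mem_iff]; grind
  rw [this, Finset.card_union_of_disjoint, Finset.card_union_of_disjoint]
  · exact Finset.disjoint_left.2 b.disjLW
  · have := b.disjLM
    have := b.disjMW
    exact Finset.disjoint_left.2 (by grind)

lemma two_le (b : G.BrickOn S L W M l m) : 2 ≤ W.card := by
  rw [← Finset.card_pair b.ne]
  have := b.memL
  have := b.memM
  exact Finset.card_le_card (by grind)

lemma cutOn (b : G.BrickOn S L W M l m) (hL : L.Nonempty) : G.CutOn S L (W.erase l ∪ M) l := by
  obtain ⟨h1, h2, h3, h4, h5, h6, h7, h8, h9, h10⟩ := b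
  refine ⟨by ext; grind, by grind, by grind, Finset.disjoint_left.2 (by grind), hL,
    ⟨m, by grind⟩, by grind⟩

lemma linkedOn (b : G.BrickOn S L W M l m) (hS : G.LinkedOn S) : G.LinkedOn W := by
  obtain ⟨h1, h2, h3, h4, h5, h6, h7, h8, h9, h10⟩ := b
  intro D hD hne hDW
  by_contra hcon
  push Not at hcon
  obtain ⟨w, hw⟩ : (W \ D).Nonempty := by
    rw [Finset.sdiff_nonempty]; exact fun h => hDW (hD.antisymm h)
  -- Each attachment is put on the side of its port, so that only edges inside `W` cross the
  -- enlarged cut.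
  obtain ⟨a, ha, b, hb, hbD, hab⟩ := hS
    (D ∪ ((if l ∈ D then L else ∅) ∪ (if m ∈ D then M else ∅))) (by grind)
    (hne.mono (by grind)) (by intro h; have := h1 w; grind)
  have := hab.symm
  have hcon' := fun x hx y hy hyD (h : G.Adj y x) => hcon x hx y hy hyD h.symm
  have h8' := fun x hx y hy (h : G.Adj y x) => h8 x hx y hy h.symm
  split_ifs at ha hbD <;> grind

/-- Once `l` is deleted from `S`, only `r` connects `L` to the rest. -/
lemma exists_adj_root (b : G.BrickOn (S.erase r) L W M l m) (hS : G.NonsepOn S) (hr : r ∈ S)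
    (hL : L.Nonempty) : ∃ x ∈ L, G.Adj r x := by
  have h := b.cutOn hL
  exact (h.swap hr).exists_adj (hS.2 l h.mem_of_erase.1)

/-- Moving one side `D₂` of a cut vertex of `W` over to `L`. -/
lemma absorb (b : G.BrickOn S L W M l m) (hc : G.CutOn W D₁ D₂ p)
    (hl : L.Nonempty → l ∈ D₂) (hm : M.Nonempty → m ∈ D₁) :
    ∃ L' l' m', G.BrickOn S L' (insert p D₁) M l' m' := by
  obtain ⟨h1, h2, h3, h4, h5, h6, h7, h8, h9, h10⟩ := b
  have e1 := hc.eq; have e2 := hc.notMemA; have e3 := hc.notMemB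
  have e4 := Finset.disjoint_left.1 hc.disj
  have e5 := fun x hx y hy (h : G.Adj y x) => hc.noAdj x hx y hy h.symm
  have hl' : ∀ x ∈ L, l ∈ D₂ := fun x hx => hl ⟨x, hx⟩
  have hm' : ∀ x ∈ M, m ∈ D₁ := fun x hx => hm ⟨x, hx⟩
  have h10' := fun x hx y hy (h : G.Adj y x) => h10 x hx y hy h.symm
  -- For empty `M` the port is a formality, and any vertex of `D₁` serves.
  obtain ⟨m', hm1, hm2⟩ : ∃ m' ∈ D₁, M.Nonempty → m' = m := by
    by_cases h : M.Nonempty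
    · exact ⟨m, hm h, by simp⟩
    · obtain ⟨m', hm'⟩ := hc.neA
      exact ⟨m', hm', by tauto⟩
  have hm2' : ∀ x ∈ M, m' = m := fun x hx => hm2 ⟨x, hx⟩
  refine ⟨L ∪ D₂, p, m', by grind, by grind, by grind, by grind, by grind, by grind, by grind,
    by grind, by grind, by grind⟩

/-- Both sides of a cut vertex of `W` carry one of the attachments `L`, `M`. -/
lemma side_of_cutOn (b : G.BrickOn (S.erase r) L W M l m) (hG : G.NoClaw) (hS : G.NonsepOn S)
    (hr : r ∈ S) (hc : G.CutOn W D₁ D₂ p) (hL : L.Nonempty) (hM : M.Nonempty)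
    (hl : l ∉ D₂) (hm : m ∉ D₂) : False := by
  obtain ⟨x, hx, hrx⟩ := b.exists_adj_root hS hr hL
  obtain ⟨y, hy, hry⟩ := b.symm.exists_adj_root hS hr hM
  obtain ⟨h1, h2, h3, h4, h5, h6, h7, h8, h9, h10⟩ := b
  have e1 := hc.eq; have e2 := hc.notMemA; have e3 := hc.notMemB
  have e4 := Finset.disjoint_left.1 hc.disj
  have e5 := fun x hx y hy (h : G.Adj y x) => hc.noAdj x hx y hy h.symm
  have h9' := fun x hx y hy (h : G.Adj y x) => h9 x hx y hy h.symm
  have h10' := fun x hx y hy (h : G.Adj y x) => h10 x hx y hy h.symm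
  have hpS : p ∈ S.erase r := by grind
  have hsub : D₂ ⊆ S.erase p := by
    intro z hz
    have := h1 z
    grind
  have hrD : r ∉ D₂ := by
    have := h1 r
    grind
  -- Containing no port, `D₂` can be left in `S - p` only through `r`. Then `r` has neighbours in
  -- `L`, `M` and `D₂`, which form a claw.
  obtain ⟨z, hz, z', hz', hzD, hzz⟩ := hS.2 p (by grind) D₂ hsub hc.neB (by
    intro h; rw [h] at hrD; grind)
  obtain rfl : z' = r := by
    by_contra hne
    have : z' ∈ S.erase r := by grind
    rw [h1] at this
    rcases this with h | h | h
    · exact hl (h9' z' h z (by grind) hzz ▸ hz)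
    · exact e5 z' (by grind) z hz hzz
    · exact hm (h10' z' h z (by grind) hzz ▸ hz)
  have k1 := h8 x hx y hy
  have k2 := h9 x hx z (by grind)
  have k3 := h10 y hy z (by grind)
  have := hG hrx hry hzz.symm (by grind) (by grind) (by grind)
  grind

/-- A port that is a cut vertex of `W` would centre a claw with leaves in `L`, `D₁` and `D₂`. -/
lemma not_port (b : G.BrickOn S L W M l m) (hG : G.NoClaw) (hS : G.LinkedOn S)
    (hc : G.CutOn W D₁ D₂ p) (hL : L.Nonempty) : p ≠ l := by
  rintro rfl
  obtain ⟨x, hx, hpx⟩ := (b.cutOn hL).exists_adj hS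
  obtain ⟨y, hy, hpy⟩ := hc.exists_adj (b.linkedOn hS)
  obtain ⟨z, hz, hpz⟩ := hc.symm.exists_adj (b.linkedOn hS)
  obtain ⟨h1, h2, h3, h4, h5, h6, h7, h8, h9, h10⟩ := b
  have e1 := hc.eq; have e2 := hc.notMemA; have e3 := hc.notMemB
  have e4 := Finset.disjoint_left.1 hc.disj
  have k1 := h9 x hx y (by grind)
  have k2 := h9 x hx z (by grind)
  have k3 := hc.noAdj y hy z hz
  have := hG hpx hpy hpz (by grind) (by grind) (by grind)
  grind

lemma shrink (b : G.BrickOn (S.erase r) L W M l m) (hG : G.NoClaw) (hS : G.NonsepOn S)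
    (hr : r ∈ S) (hK : K ⊆ W) (hcl : G.CliqueOn K) (hW : ¬ G.NonsepOn W) :
    ∃ L' W' M' l' m', G.BrickOn (S.erase r) L' W' M' l' m' ∧ K ⊆ W' ∧ W'.card < W.card := by
  obtain ⟨p, D₁, D₂, hc⟩ := exists_cutOn (b.linkedOn (hS.2 r hr)) hW
  have main : ∀ D₁ D₂, G.CutOn W D₁ D₂ p → K ⊆ insert p D₁ →
      ∃ L' W' M' l' m', G.BrickOn (S.erase r) L' W' M' l' m' ∧ K ⊆ W' ∧ W'.card < W.card := by
    intro D₁ D₂ hc hKD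
    have hlt : (insert p D₁).card < W.card := by
      rw [hc.card_insert, hc.card_eq]
      have := hc.neB.card_pos
      omega
    have e1 := hc.eq
    have hl := b.memL
    have hm := b.memM
    have p1 := b.not_port hG (hS.2 r hr) hc
    have p2 := b.symm.not_port hG (hS.2 r hr) hc
    have s1 := b.side_of_cutOn hG hS hr hc
    have s2 := b.side_of_cutOn hG hS hr hc.symm
    have e4 := Finset.disjoint_left.1 hc.disj
    -- By `side_of_cutOn` and `not_port`, two nonempty attachments have their ports on different
    -- sides of `p`, so the discarded side can join one of them.
    have : ((L.Nonempty → l ∈ D₂) ∧ (M.Nonempty → m ∈ D₁)) ∨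
        ((M.Nonempty → m ∈ D₂) ∧ (L.Nonempty → l ∈ D₁)) := by
      by_cases hL : L.Nonempty <;> by_cases hM : M.Nonempty <;> grind
    rcases this with ⟨h, h'⟩ | ⟨h, h'⟩
    · obtain ⟨L', l', m', b'⟩ := b.absorb hc h h'
      exact ⟨L', _, M, l', m', b', hKD, hlt⟩
    · obtain ⟨M', m', l', b'⟩ := b.symm.absorb hc h h'
      exact ⟨L, _, M', l', m', b'.symm, hKD, hlt⟩
  by_cases h : K ⊆ insert p D₁
  · exact main D₁ D₂ hc h
  · refine main D₂ D₁ hc.symm fun x hx => ?_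
    obtain ⟨y, hy, hyD⟩ := Finset.not_subset.1 h
    have e1 := hc.eq
    by_contra hx'
    exact hc.noAdj x (by grind) y (by grind) (hcl x hx y hy (by grind))

lemma exists_nonsepOn (hG : G.NoClaw) (hS : G.NonsepOn S) (hr : r ∈ S) (hcl : G.CliqueOn K) :
    ∀ n, ∀ L W M l m, W.card = n → G.BrickOn (S.erase r) L W M l m → K ⊆ W →
    ∃ L' W' M' l' m', G.BrickOn (S.erase r) L' W' M' l' m' ∧ K ⊆ W' ∧ G.NonsepOn W' := by
  intro n
  induction n using Nat.strong_induction_on with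
  | _ n ih =>
    intro L W M l m hn b hK
    by_cases hW : G.NonsepOn W
    · exact ⟨L, W, M, l, m, b, hK, hW⟩
    · obtain ⟨L', W', M', l', m', b', hK', hlt⟩ := b.shrink hG hS hr hK hcl hW
      exact ih W'.card (by omega) L' W' M' l' m' rfl b' hK'

lemma clique_nbr (b : G.BrickOn S L W M l m) (hG : G.NoClaw) (hS : G.LinkedOn S)
    (hL : L.Nonempty) : G.CliqueOn (G.nbr W l) := by
  intro x hx y hy
  have h := (b.cutOn hL).symm.clique_nbr hG hS
  have := G.irrefl (v := l)
  exact h x (by grind) y (by grind)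

/-- If the clique `K'` uses the port `l`, it contains all neighbours of `l` in `W`. -/
lemma nbr_subset (b : G.BrickOn (S.erase r) L W M l m) (hS : G.LinkedOn (S.erase r))
    (hatt : G.AttachOn S K') (hK : K'.erase r ⊆ W) (hL : L.Nonempty) (hl : l ∈ K') :
    G.nbr W l ⊆ K'.erase r := by
  obtain ⟨x, hx, hlx⟩ := (b.cutOn hL).exists_adj hS
  obtain ⟨h1, h2, h3, h4, h5, h6, h7, h8, h9, h10⟩ := b
  intro w hw
  rw [mem_nbr] at hw
  have k1 := h1 x
  have k2 := h1 w
  by_contra hwK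
  have := h9 x hx w hw.1 (hatt l hl x (by grind) w (by grind) (by grind) (by grind) (by grind)
    hlx hw.2)
  exact hw.2.ne this.symm

lemma exists_mem_ne (b : G.BrickOn (S.erase r) L W M l m) (hS : G.LinkedOn (S.erase r))
    (hatt : G.AttachOn S K') (hK : K'.erase r ⊆ W) (hne : (K'.erase r).Nonempty)
    (hL : L.Nonempty) : ∃ k ∈ K'.erase r, k ≠ l := by
  obtain ⟨k, hk⟩ := hne
  by_cases hkl : k = l
  · obtain ⟨t, ht, hlt⟩ := (b.linkedOn hS).exists_adj b.memL b.two_le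
    exact ⟨t, b.nbr_subset hS hatt hK hL (by grind) (by grind), hlt.ne'⟩
  · exact ⟨k, hk, hkl⟩

/-- If the given vertex is a port, `nbr_subset` puts all its neighbours in `W` into `K'`, and
nonseparability provides one different from the other port. -/
lemma exists_mem_ne_ne (b : G.BrickOn (S.erase r) L W M l m) (hS : G.LinkedOn (S.erase r))
    (hatt : G.AttachOn S K') (hK : K'.erase r ⊆ W) (hne : (K'.erase r).Nonempty)
    (hL : L.Nonempty) (hM : M.Nonempty) (hW : G.NonsepOn W) (hcard : 3 ≤ W.card) :
    ∃ k ∈ K'.erase r, k ≠ l ∧ k ≠ m := by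
  obtain ⟨k, hk⟩ := hne
  by_cases hkl : k = l
  · obtain ⟨t, ht, htm, hlt⟩ := hW.exists_adj_ne b.memL hcard b.ne.symm
    exact ⟨t, b.nbr_subset hS hatt hK hL (by grind) (by grind), hlt.ne', htm⟩
  by_cases hkm : k = m
  · obtain ⟨t, ht, htm, hlt⟩ := hW.exists_adj_ne b.memM hcard b.ne
    exact ⟨t, b.symm.nbr_subset hS hatt hK hM (by grind) (by grind), htm, hlt.ne'⟩
  · exact ⟨k, hk, hkl, hkm⟩

end BrickOn

/-! ### Packing around the isolated block -/

namespace BrickOn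

section

variable (hG : G.NoClaw) (ih : ∀ T : Finset V, T.card < S.card → G.PackableOn T)
  (hS : G.NonsepOn S) (hr : r ∈ S)
include hG ih hS hr

lemma card_lt (b : G.BrickOn (S.erase r) L W M l m) : L.card + W.card + M.card < S.card := by
  have := b.card_eq
  have := Finset.card_erase_add_one hr
  omega

/-- If `|M|` is not `1` modulo `3`, then `M`, possibly together with `m`, can be packed, and what
is left of `W` is nonseparable. -/
lemma exists_trim (b : G.BrickOn (S.erase r) L W M l m) (hW : G.NonsepOn W)
    (hM : M.card % 3 ≠ 1) :
    ∃ W₀ M₀, W₀ ⊆ W ∧ l ∈ W₀ ∧ G.NonsepOn W₀ ∧ G.TripleSplit M₀ ∧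
      (∀ x, x ∈ W ∨ x ∈ M ↔ x ∈ W₀ ∨ x ∈ M₀) ∧ (∀ x ∈ M₀, x ∉ W₀) ∧
      M₀.card % 3 = 0 ∧ W₀.card + M₀.card = W.card + M.card ∧
      (W₀ = W ∨ M.Nonempty ∧ W₀ = W.erase m) := by
  have hlt := b.card_lt hG ih hS hr
  have hW2 := b.two_le
  have : M.card % 3 = 0 ∨ M.card % 3 = 2 := by omega
  rcases this with h | h
  · refine ⟨W, M, subset_rfl, b.memL, hW, ?_, fun _ => Iff.rfl, b.disjMW, h, rfl, .inl rfl⟩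
    rcases M.eq_empty_or_nonempty with rfl | hne
    · exact .empty
    · exact (ih M (by omega)).chain_zero _ _ ((b.symm.cutOn hne).chain_side hG hS hr) h
  · have hne : M.Nonempty := Finset.card_pos.1 (by omega)
    have hc := b.symm.cutOn hne
    have h1 := hc.card_insert
    have h2 := Finset.card_erase_add_one b.memM
    have h3 := b.memM
    have h4 := b.disjMW
    refine ⟨W.erase m, insert m M, by grind, ?_,
      hW.erase_of_clique b.memM (b.symm.clique_nbr hG (hS.2 r hr) hne),
      (ih (insert m M) (by omega)).chain_zero _ _ (hc.chain_side_insert hG hS hr) (by omega),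
      by grind, by grind, by omega, by omega, .inr ⟨hne, rfl⟩⟩
    have := b.memL
    have := b.ne
    grind

/-- After `M` is trimmed, `|L| + |W₀|` has residue 1. For `|L|` of residue 0 or 2, `L` is packed
alone or with `l`, and a vertex of `K'` is left out of the rest of `W₀`. For residue 1, `l` is the
middle of a path from `L` to `W₀`. -/
lemma tripleSplit_of_card_ne_one (b : G.BrickOn (S.erase r) L W M l m) (hW : G.NonsepOn W)
    (hcard : S.card % 3 = 2) (hclq : G.CliqueOn K') (hatt : G.AttachOn S K')
    (hK : K'.erase r ⊆ W) (hne : (K'.erase r).Nonempty) (hM : M.card % 3 ≠ 1) :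
    ∃ r' ∈ K', r ≠ r' ∧ G.TripleSplit ((S.erase r).erase r') := by
  obtain ⟨W₀, M₀, hWs, hl, hW0, hTM, hmem, hd, hM0, hcc, hor⟩ := b.exists_trim hG ih hS hr hW hM
  have hlt := b.card_lt hG ih hS hr
  have hlt' := Finset.card_erase_add_one hr
  have hce := b.card_eq
  have hel := Finset.card_erase_add_one hl
  have hlink := hS.2 r hr
  have b1 := b.mem_iff
  have b2 := b.disjLW
  have b3 := b.disjLM
  have hcl0 : L.Nonempty → G.CliqueOn (G.nbr W₀ l) := fun hL x hx y hy =>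
    b.clique_nbr hG hlink hL x (by grind) y (by grind)
  -- a vertex of `K'` in the remaining set
  have hmem0 : ∃ k ∈ K'.erase r, k ∈ W₀ := by
    rcases hor with h | ⟨hMne, h⟩
    · obtain ⟨k, hk⟩ := hne
      exact ⟨k, hk, by grind⟩
    · obtain ⟨k, hk, hkm⟩ := b.symm.exists_mem_ne hlink hatt hK hne hMne
      exact ⟨k, hk, by grind⟩
  have hmem1 : L.Nonempty → 2 ≤ W₀.card → ∃ k ∈ K'.erase r, k ∈ W₀.erase l := by
    intro hL h2
    rcases hor with h | ⟨hMne, h⟩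
    · obtain ⟨k, hk, hkl⟩ := b.exists_mem_ne hlink hatt hK hne hL
      exact ⟨k, hk, by grind⟩
    · have := Finset.card_erase_add_one b.memM
      obtain ⟨k, hk, hkl, hkm⟩ := b.exists_mem_ne_ne hlink hatt hK hne hL hMne hW
        (by rw [h] at h2; omega)
      exact ⟨k, hk, by grind⟩
  have : L.card % 3 = 0 ∨ L.card % 3 = 2 ∨ L.card % 3 = 1 := by omega
  rcases this with h | h | h
  · have hTL : G.TripleSplit L := by
      rcases L.eq_empty_or_nonempty with rfl | hLne
      · exact .empty
      · exact (ih L (by omega)).chain_zero _ _ ((b.cutOn hLne).chain_side hG hS hr) h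
    obtain ⟨k, hk, hkW⟩ := hmem0
    have hTW := (ih W₀ (by have := b.two_le; omega)).nonsep_one hW0 (by omega) k hkW
    refine ⟨k, by grind, by grind, ((hTL.union hTM (Finset.disjoint_left.2 ?_)).union_eq hTW
      ?_ ?_)⟩
    · grind
    · grind
    · grind
  · have hLne : L.Nonempty := Finset.card_pos.1 (by omega)
    have hc := b.cutOn hLne
    have h1 := hc.card_insert
    have hTL := (ih (insert l L) (by have := b.two_le; omega)).chain_zero _ _
      (hc.chain_side_insert hG hS hr) (by omega)
    obtain ⟨k, hk, hkW⟩ := hmem1 hLne (by omega)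
    have hTW := (ih (W₀.erase l) (by omega)).nonsep_one
      (hW0.erase_of_clique hl (hcl0 hLne)) (by omega) k hkW
    refine ⟨k, by grind, by grind, ((hTL.union hTM (Finset.disjoint_left.2 ?_)).union_eq hTW
      ?_ ?_)⟩
    · grind
    · grind
    · grind
  · have hLne : L.Nonempty := Finset.card_pos.1 (by omega)
    have hc := b.cutOn hLne
    have h3 : 3 ≤ W₀.card := by omega
    obtain ⟨k, hk, hkW⟩ := hmem1 hLne (by omega)
    have hir := G.irrefl (v := l)
    have hnbr : G.nbr (W₀.erase l) l = G.nbr W₀ l := by ext; grind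
    -- The port has at least two neighbours in `W₀`, which is what `NonsepOn.chainOn` requires of
    -- the end cliques.
    have key : ∀ v, ∃ x ∈ G.nbr W₀ l, x ≠ v := by
      intro v
      by_cases hvl : v = l
      · obtain ⟨t, ht, hlt⟩ := hW0.1.exists_adj hl (by omega)
        exact ⟨t, by grind, by grind⟩
      · obtain ⟨t, ht, htv, hlt⟩ := hW0.exists_adj_ne hl h3 hvl
        exact ⟨t, by grind, htv⟩
    have hch : G.ChainOn (W₀.erase l) (G.nbr W₀ l) (K'.erase r ∩ W₀.erase l) := by
      refine (hW0.erase_of_clique hl (hcl0 hLne)).chainOn (by grind) (by grind) ?_ ⟨k, by grind⟩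
        (hcl0 hLne) (fun x hx y hy => hclq x (by grind) y (by grind)) ?_
      · obtain ⟨x, hx, -⟩ := key l
        exact ⟨x, hx⟩
      · intro v
        obtain ⟨x, hx, hxv⟩ := key v
        exact ⟨x, .inl hx, hxv⟩
    obtain ⟨z, hz, k', hk', hzk, hTW⟩ := (ih (W₀.erase l) (by omega)).chain_two _ _ hch
      (by rw [← hnbr]; exact hG.attachOn_nbr (by grind))
      (hatt.mono (by grind) (by grind) (by grind)) (by omega)
    obtain ⟨s, hs, hTL⟩ := (ih L (by have := b.two_le; omega)).chain_one _ _
      (hc.chain_side hG hS hr).symm (hc.attachOn_nbr_right hG) h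
    rw [mem_nbr] at hs hz
    refine ⟨k', by grind, by grind, ((hTL.union hTM (Finset.disjoint_left.2 ?_)).union hTW
      (Finset.disjoint_left.2 ?_)).insert_eq hs.2.symm hz.2 ?_ ?_ ?_ ?_ ?_⟩
    · grind
    · grind
    · grind
    · grind
    · grind
    · grind
    · grind

/-- `M` together with its two attaching vertices `r` and `m` is a chain. -/
lemma chain_both (b : G.BrickOn (S.erase r) L W M l m) (hM : M.Nonempty) :
    G.ChainOn (insert r (insert m M)) {r} {m} := by
  obtain ⟨x, hx, hrx⟩ := b.symm.exists_adj_root hS hr hM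
  have hlin := (b.symm.cutOn hM).linkedOn_insert hG (hS.2 r hr)
  obtain ⟨h1, h2, h3, h4, h5, h6, h7, h8, h9, h10⟩ := b
  have hrS := h1 r
  refine ⟨hlin.insert (by grind) (u := x) (by grind) hrx, by grind, by grind, by simp, by simp,
    by intro; grind, by intro; grind, ?_⟩
  intro v hv D hD hvD hne hadj
  by_contra hcon
  push Not at hcon
  have hDM : D ⊆ M := by grind
  have hvS : v ∈ S := by grind
  -- `S - v` is linked, and an edge leaving `M` can end only in `r` or `m`.
  obtain ⟨a, ha, b, hb, hbD, hab⟩ := hS.2 v hvS D (by grind) hne (by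
    intro h
    have h1l := h1 l
    have h1m := h1 m
    have : l ∈ D ∨ m ∈ D := by grind
    grind)
  have k1 := h1 b
  have k2 : b ∈ insert r (insert m M) := by
    by_contra hb'
    have : b ∈ L ∨ b ∈ W := by grind
    rcases this with h | h
    · exact h8 b h a (hDM ha) hab.symm
    · have := h10 a (hDM ha) b h hab
      grind
  exact hadj a ha b k2 (by grind) hbD hab

/-- Leaving out a neighbour `s ∈ L` of `r` instead of `r` makes `L - s` packable, and `r` and `m`
complete `M` to residue 0. Then `|W|` has residue 2, so `W - m` has residue 1 and can spare a vertex
of `K'`. -/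
lemma tripleSplit_of_card_eq_one (b : G.BrickOn (S.erase r) L W M l m) (hW : G.NonsepOn W)
    (hcard : S.card % 3 = 2) (hatt : G.AttachOn S K')
    (hK : K'.erase r ⊆ W) (hne : (K'.erase r).Nonempty) (hL1 : L.card % 3 = 1)
    (hM1 : M.card % 3 = 1) (hKL : G.nbr L r ⊆ K) :
    ∃ k ∈ K, ∃ r' ∈ K', k ≠ r' ∧ G.TripleSplit ((S.erase k).erase r') := by
  have hlt := b.card_lt hG ih hS hr
  have hlt' := Finset.card_erase_add_one hr
  have hce := b.card_eq
  have hem := Finset.card_erase_add_one b.memM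
  have hlink := hS.2 r hr
  have hLne : L.Nonempty := Finset.card_pos.1 (by omega)
  have hMne : M.Nonempty := Finset.card_pos.1 (by omega)
  have hc := b.cutOn hLne
  obtain ⟨k, hk, hkm⟩ := b.symm.exists_mem_ne hlink hatt hK hne hMne
  have hTW := (ih (W.erase m) (by omega)).nonsep_one
      (hW.erase_of_clique b.memM (b.symm.clique_nbr hG hlink hMne)) (by omega) k (by grind)
  obtain ⟨s, hs, hTL⟩ := (ih L (by have := b.two_le; omega)).chain_one _ _
      (hc.chain_side hG hS hr) (hc.attachOn_nbr_left hG) hL1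
  have hch := b.chain_both hG ih hS hr hMne
  obtain ⟨h1, h2, h3, h4, h5, h6, h7, h8, h9, h10⟩ := b
  have hrS := h1 r
  have hci : (insert r (insert m M)).card = M.card + 2 := by
    rw [Finset.card_insert_of_notMem (by grind), Finset.card_insert_of_notMem (by grind)]
  have hW2 : 2 ≤ W.card := by omega
  have hTM := (ih (insert r (insert m M)) (by have := hLne.card_pos; omega)).chain_zero _ _ hch
    (by omega)
  have hrS' : r ∉ L ∧ r ∉ W ∧ r ∉ M := by grind
  have hmem : ∀ x, x ∈ S ↔ x = r ∨ x ∈ L ∨ x ∈ W ∨ x ∈ M := by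
    intro x
    have := h1 x
    grind
  refine ⟨s, hKL hs, k, by grind, by grind, (hTL.union hTM (Finset.disjoint_left.2 ?_)).union_eq
    hTW ?_ ?_⟩
  · grind
  · grind
  · grind

end

end BrickOn

/-! ### Residue 2 in nonseparable sets, and the induction -/

section induction

variable (hG : G.NoClaw) (ih : ∀ T : Finset V, T.card < S.card → G.PackableOn T)
include hG ih

lemma chain_two_of_nonsep_aux (hS : G.NonsepOn S) (hK : K ⊆ S)
    (hatt : G.AttachOn S K) (hK' : K' ⊆ S) (hclq' : G.CliqueOn K') (hatt' : G.AttachOn S K')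
    (hr : r ∈ K) (hne : (K'.erase r).Nonempty) (hcard : S.card % 3 = 2) :
    ∃ r ∈ K, ∃ r' ∈ K', r ≠ r' ∧ G.TripleSplit ((S.erase r).erase r') := by
  have hrS := hK hr
  have hlt := Finset.card_erase_add_one hrS
  obtain ⟨k, hk⟩ := id hne
  by_cases h1 : G.NonsepOn (S.erase r)
  · exact ⟨r, hr, k, by grind, by grind,
      (ih (S.erase r) (by omega)).nonsep_one h1 (by omega) k (by grind)⟩
  obtain ⟨c, A, B, hc⟩ := exists_cutOn (hS.2 r hrS) h1
  obtain ⟨a, ha⟩ := hc.neA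
  obtain ⟨a', ha'⟩ := hc.neB
  have hd := Finset.disjoint_left.1 hc.disj ha
  -- The search for the block starts from all of `S - r` with empty attachments; the ports are any
  -- two distinct vertices.
  have hb0 : G.BrickOn (S.erase r) ∅ (S.erase r) ∅ a a' := by
    have := hc.eq
    constructor <;> grind
  obtain ⟨L, W, M, l, m, b, hKW, hW⟩ := BrickOn.exists_nonsepOn hG hS hrS (K := K'.erase r)
    (fun x hx y hy => hclq' x (by grind) y (by grind)) _ _ _ _ _ _ rfl hb0 (by grind)
  by_cases hM : M.card % 3 = 1
  · by_cases hL : L.card % 3 = 1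
    -- The neighbours of `r` in `L` or those in `M` all lie in `K`: otherwise `AttachOn` at `r`
    -- would give an edge between `L` and `M`.
    · by_cases hKL : G.nbr L r ⊆ K
      · exact b.tripleSplit_of_card_eq_one hG ih hS hrS hW hcard hatt' hKW hne hL hM hKL
      · refine b.symm.tripleSplit_of_card_eq_one hG ih hS hrS hW hcard hatt' hKW hne hM hL ?_
        obtain ⟨x, hx, hxK⟩ := Finset.not_subset.1 hKL
        intro y hy
        rw [mem_nbr] at hx hy
        by_contra hyK
        have b1 := b.mem_iff
        have b2 := b.disjLM
        exact b.noAdj x hx.1 y hy.1 (hatt r hr x (by grind) y (by grind) hxK hyK (by grind)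
          hx.2 hy.2)
    · obtain ⟨r', h⟩ := b.symm.tripleSplit_of_card_ne_one hG ih hS hrS hW hcard hclq' hatt' hKW
        hne hL
      exact ⟨r, hr, r', h⟩
  · obtain ⟨r', h⟩ := b.tripleSplit_of_card_ne_one hG ih hS hrS hW hcard hclq' hatt' hKW hne hM
    exact ⟨r, hr, r', h⟩

lemma chain_two_of_nonsep (hS : G.NonsepOn S) (hC : G.ChainOn S K K')
    (hatt : G.AttachOn S K) (hatt' : G.AttachOn S K') (hcard : S.card % 3 = 2) :
    ∃ r ∈ K, ∃ r' ∈ K', r ≠ r' ∧ G.TripleSplit ((S.erase r).erase r') := by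
  -- This fails only if both cliques are the same single vertex; since `|S| ≥ 2`, deleting it would
  -- leave a nonempty set missing both, against `comp`.
  have : ∃ r ∈ K, (K'.erase r).Nonempty := by
    by_contra hcon
    push Not at hcon
    obtain ⟨r, hr⟩ := hC.ne
    obtain ⟨r', hr'⟩ := hC.ne'
    have h1 : ∀ x ∈ K, ∀ y ∈ K', x = y := by
      intro x hx y hy
      have := hcon x hx
      by_contra hne
      have : y ∈ K'.erase x := by grind
      grind
    have hrS := hC.sub hr
    have hlt := Finset.card_erase_add_one hrS
    obtain ⟨d, hd, hd'⟩ := hC.comp r hrS (S.erase r) (by grind) (by grind)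
      (Finset.card_pos.1 (by omega)) (by grind)
    grind
  obtain ⟨r, hr, hne⟩ := this
  exact chain_two_of_nonsep_aux hG ih hS hC.sub hatt hC.sub' hC.clique' hatt' hr hne hcard

end induction

theorem NoClaw.packableOn (hG : G.NoClaw) : ∀ n, ∀ S : Finset V, S.card = n → G.PackableOn S := by
  intro n
  induction n using Nat.strong_induction_on with
  | _ n ih =>
    intro S hn
    have ih : ∀ T : Finset V, T.card < S.card → G.PackableOn T :=
      fun T hT => ih T.card (by omega) T rfl
    refine ⟨tripleSplit_of_nonsep hG ih,
      fun hS hcard r hr => tripleSplit_erase_of_nonsep hG ih hS hcard hr, ?_, ?_, ?_⟩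
    · intro K K' hC hcard
      by_cases hS : G.NonsepOn S
      · exact tripleSplit_of_nonsep hG ih hS hcard
      · obtain ⟨c, A, B, hc⟩ := exists_cutOn hC.linked hS
        exact chain_zero_of_cutOn hG ih hc hC hcard
    · intro K K' hC hatt hcard
      by_cases hS : G.NonsepOn S
      · obtain ⟨r, hr⟩ := hC.ne
        exact ⟨r, hr, tripleSplit_erase_of_nonsep hG ih hS hcard (hC.sub hr)⟩
      · obtain ⟨c, A, B, hc⟩ := exists_cutOn hC.linked hS
        exact chain_one_of_cutOn hG ih hc hC hatt hcard
    · intro K K' hC hatt hatt' hcard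
      by_cases hS : G.NonsepOn S
      · exact chain_two_of_nonsep hG ih hS hC hatt hatt' hcard
      · obtain ⟨c, A, B, hc⟩ := exists_cutOn hC.linked hS
        exact chain_two_of_cutOn hG ih hc hC hatt hatt' hcard

/-! ### Translation to induced claws, connectivity and Λ-factors -/

lemma IsClawFree.noClaw (h : G.IsClawFree) : G.NoClaw := by
  intro v a b c ha hb hc hab hac hbc
  by_contra hcon
  push Not at hcon
  obtain ⟨n1, n2, n3⟩ := hcon
  refine h ⟨⟨⟨Sum.elim (fun _ => v) ![a, b, c], ?_⟩, ?_⟩⟩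
  · have := ha.ne; have := hb.ne; have := hc.ne
    rintro (i | i) (j | j) hij
    · simp [Subsingleton.elim i j]
    · fin_cases j <;> simp_all
    · fin_cases i <;> simp_all
    · fin_cases i <;> fin_cases j <;> simp_all
  · intro x y
    change G.Adj (Sum.elim (fun _ => v) ![a, b, c] x) (Sum.elim (fun _ => v) ![a, b, c] y) ↔ _
    have n1' := fun h => n1 (G.adj_symm h)
    have n2' := fun h => n2 (G.adj_symm h)
    have n3' := fun h => n3 (G.adj_symm h)
    rcases x with i | i <;> rcases y with j | j
    · simp
    · fin_cases j <;> simp_all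
    · fin_cases i <;> simp_all [G.adj_comm]
    · fin_cases i <;> fin_cases j <;> simp_all

lemma linkedOn_of_connected [Fintype V] (X : Finset V) (hS : ∀ x, x ∈ S ↔ x ∉ X)
    (h : (G.induce (X : Set V)ᶜ).Connected) : G.LinkedOn S := by
  intro A hA hne hAS
  by_contra hcon
  push Not at hcon
  obtain ⟨a, ha⟩ := hne
  obtain ⟨b, hb⟩ : (S \ A).Nonempty := by
    rw [Finset.sdiff_nonempty]; exact fun h => hAS (hA.antisymm h)
  have hmem : ∀ x, x ∈ S → x ∈ (X : Set V)ᶜ := fun x hx => by simpa using (hS x).1 hx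
  have key : ∀ u w : ((X : Set V)ᶜ : Set V), (G.induce (X : Set V)ᶜ).Reachable u w →
      u.1 ∈ A → w.1 ∈ A := by
    rintro u w ⟨p⟩
    induction p with
    | nil => exact id
    | @cons u v w huv p ih =>
      intro hu
      apply ih
      by_contra hv
      exact hcon u hu v ((hS _).2 (fun h => v.2 h)) hv huv
  have := key ⟨a, hmem a (hA ha)⟩ ⟨b, hmem b (by grind)⟩ (h.preconnected _ _) ha
  grind

lemma IsKConnected.nonsepOn_univ [Fintype V] (h : G.IsKConnected 2) :
    G.NonsepOn Finset.univ :=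
  ⟨linkedOn_of_connected ∅ (by simp) (h.2 ∅ (by simp)),
    fun v _ => linkedOn_of_connected {v} (by simp) (h.2 {v} (by simp))⟩

/-- A partition into three-vertex paths, as a function assigning to each vertex its path. -/
lemma TripleSplit.exists_path (h : G.TripleSplit S) : ∃ f : V → Fin 3 → V, ∀ v ∈ S,
    Function.Injective (f v) ∧ (∃ i, f v i = v) ∧ (∀ i, f v i ∈ S ∧ f (f v i) = f v) ∧
    G.Adj (f v 0) (f v 1) ∧ G.Adj (f v 1) (f v 2) := by
  induction h with
  | empty => exact ⟨fun v _ => v, by simp⟩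
  | @cons T a b c hab hbc hac ha hb hc hT ih =>
    obtain ⟨f, hf⟩ := ih
    refine ⟨fun v => if v = a ∨ v = b ∨ v = c then ![a, b, c] else f v, fun v hv => ?_⟩
    by_cases h : v = a ∨ v = b ∨ v = c
    · simp only [h, if_true]
      refine ⟨?_, ?_, ?_, by simpa, by simpa⟩
      · have := hab.ne; have := hbc.ne
        intro i j hij
        fin_cases i <;> fin_cases j <;> simp_all
      · rcases h with rfl | rfl | rfl
        · exact ⟨0, rfl⟩
        · exact ⟨1, rfl⟩
        · exact ⟨2, rfl⟩
      · intro i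
        fin_cases i <;> simp
    · have hvT : v ∈ T := by grind
      obtain ⟨h1, h2, h3, h4, h5⟩ := hf v hvT
      simp only [h, if_false]
      refine ⟨h1, h2, fun i => ?_, h4, h5⟩
      obtain ⟨h6, h7⟩ := h3 i
      have : ¬ (f v i = a ∨ f v i = b ∨ f v i = c) := by grind
      simp only [this, if_false]
      exact ⟨by grind, h7⟩

/-- The spanning subgraph formed by a family of disjoint three-vertex paths covering all
vertices. -/
def pathFamily (G : SimpleGraph V) (f : V → Fin 3 → V)
    (h01 : ∀ v, G.Adj (f v 0) (f v 1)) (h12 : ∀ v, G.Adj (f v 1) (f v 2)) : G.Subgraph where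
  verts := Set.univ
  Adj u w := f u = f w ∧ ∃ i j, (pathGraph 3).Adj i j ∧ f u i = u ∧ f u j = w
  adj_sub := by
    rintro u w ⟨-, i, j, hij, hu, hw⟩
    have h1 := h01 u
    have h2 := h12 u
    suffices G.Adj (f u i) (f u j) by rwa [hu, hw] at this
    clear hu hw
    rw [pathGraph_adj] at hij
    have h1' := h1.symm
    have h2' := h2.symm
    fin_cases i <;> fin_cases j <;> simp_all
  edge_vert _ := Set.mem_univ _
  symm := by
    constructor
    rintro u w ⟨h, i, j, hij, hu, hw⟩
    exact ⟨h.symm, j, i, hij.symm, h ▸ hw, h ▸ hu⟩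

/-- Edges of `pathFamily` join vertices with equal `f`, so the component of `v` is exactly the image
of `f v`. -/
lemma hasLambdaFactor_of_path (f : V → Fin 3 → V) (hinj : ∀ v, Function.Injective (f v))
    (hself : ∀ v, ∃ i, f v i = v) (hf : ∀ v i, f (f v i) = f v)
    (h01 : ∀ v, G.Adj (f v 0) (f v 1)) (h12 : ∀ v, G.Adj (f v 1) (f v 2)) :
    G.HasLambdaFactor := by
  set P := G.pathFamily f h01 h12 with hP
  refine ⟨P, fun C => ?_, fun v => Set.mem_univ v⟩
  induction C using ConnectedComponent.ind with
  | _ v =>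
  have hadj : ∀ i j, P.coe.Adj ⟨f v i, Set.mem_univ _⟩ ⟨f v j, Set.mem_univ _⟩ ↔
      (pathGraph 3).Adj i j := by
    intro i j
    change (f (f v i) = f (f v j) ∧ ∃ i' j', (pathGraph 3).Adj i' j' ∧ f (f v i) i' = f v i ∧
      f (f v i) j' = f v j) ↔ _
    rw [hf, hf]
    constructor
    · rintro ⟨-, i', j', h, hi, hj⟩
      rwa [hinj v hi, hinj v hj] at h
    · exact fun h => ⟨rfl, i, j, h, rfl, rfl⟩
  have hreach : ∀ i j, P.coe.Reachable ⟨f v i, Set.mem_univ _⟩ ⟨f v j, Set.mem_univ _⟩ := by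
    have a1 := ((hadj 0 1).2 (by simp [pathGraph_adj])).reachable
    have a2 := ((hadj 1 2).2 (by simp [pathGraph_adj])).reachable
    have a3 : ∀ i, P.coe.Reachable ⟨f v 0, Set.mem_univ _⟩ ⟨f v i, Set.mem_univ _⟩ := by
      intro i
      fin_cases i
      · exact .refl _
      · exact a1
      · exact a1.trans a2
    exact fun i j => (a3 i).symm.trans (a3 j)
  have hconst : ∀ u w : P.verts, P.coe.Reachable u w → f u = f w := by
    rintro u w ⟨p⟩
    induction p with
    | nil => rfl
    | cons h p ih => exact Eq.trans (show _ from h.1) ih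
  obtain ⟨i₀, hi₀⟩ := hself v
  have hv : (⟨f v i₀, Set.mem_univ _⟩ : P.verts) = v := Subtype.ext hi₀
  let e : Fin 3 → (P.coe.connectedComponentMk v).supp := fun i =>
    ⟨⟨f v i, Set.mem_univ _⟩, by
      rw [ConnectedComponent.mem_supp_iff, ConnectedComponent.eq]
      exact (hreach i i₀).trans (by rw [hv])⟩
  have he : Function.Bijective e := by
    refine ⟨fun i j hij => hinj v (congrArg (fun x => x.1.1) hij), fun ⟨w, hw⟩ => ?_⟩
    rw [ConnectedComponent.mem_supp_iff, ConnectedComponent.eq] at hw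
    obtain ⟨i, hi⟩ := hself w
    refine ⟨i, Subtype.ext (Subtype.ext ?_)⟩
    rw [hconst _ _ hw] at hi
    exact hi
  refine ⟨RelIso.symm ⟨Equiv.ofBijective e he, ?_⟩⟩
  intro i j
  exact hadj i j

end SimpleGraph

theorem mainTheorem2 {V : Type*} [Fintype V] (G : SimpleGraph V)
    (h2con : G.IsKConnected 2) (hclaw : G.IsClawFree)
    (hcard : Fintype.card V ≡ 1 [MOD 3]) (x : V) :
    (G.induce ({x}ᶜ : Set V)).HasLambdaFactor := by
  classical
  have hT := (hclaw.noClaw.packableOn _ Finset.univ rfl).nonsep_one h2con.nonsepOn_univ hcard x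
    (Finset.mem_univ x)
  obtain ⟨f, hf⟩ := hT.exists_path
  have hmem : ∀ v : ({x}ᶜ : Set V), v.1 ∈ Finset.univ.erase x := fun v =>
    Finset.mem_erase.2 ⟨v.2, Finset.mem_univ _⟩
  have hne : ∀ (v : ({x}ᶜ : Set V)) i, f v i ∈ ({x}ᶜ : Set V) := fun v i => by
    simpa using ((hf v (hmem v)).2.2.1 i).1
  refine SimpleGraph.hasLambdaFactor_of_path (fun v i => ⟨f v i, hne v i⟩) (fun v i j h => ?_)
    (fun v => ?_) (fun v i => ?_) (fun v => (hf v (hmem v)).2.2.2.1)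
    (fun v => (hf v (hmem v)).2.2.2.2)
  · exact (hf v (hmem v)).1 (congrArg Subtype.val h)
  · obtain ⟨i, hi⟩ := (hf v (hmem v)).2.1
    exact ⟨i, Subtype.ext hi⟩
  · funext j
    exact Subtype.ext (congrFun ((hf v (hmem v)).2.2.1 i).2 j)
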